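/- Let $Q_n$ be the $n$-dimensional hypercube: its vertices are the binary strings of length $n$, and two strings are adjacent if and only if they differ in exactly one position. Let $K_{1,r}$ be the star with $r$ leaves. For a set $F$ of subgraphs of a graph $G$, let $G-F$ be the graph obtained from $G$ by deleting all vertices of all members of $F$. For a connected graph $T$, the $T$-structure connectivity $\kappa(G;T)$ (respectively, the $T$-substructure connectivity $\kappa^s(G;T)$) is the minimum cardinality of a set $F$ of subgraphs of $G$, each isomorphic to $T$ (respectively, each isomorphic to a connected subgraph of $T$), such that $G-F$ is disconnected, i.e. has more than one component. For integers $r\ge 2$ put $$f(r)=\begin{cases}\max\left\{\dfrac{r+7}{2},\ \dfrac{r^2+4r+3}{8}\right\}, & r \text{ odd},\\[2ex] \max\left\{\dfrac{r^2+2r}{8},\ \dfrac{r+8}{2},\ \dfrac{r^2+6r+12}{12}\right\}, & r \text{ even}.\end{cases}$$ Theorem. If $r\ge 2$ and $n$ are integers with $n>f(r)$, then $$\kappa(Q_n;K_{1,r})=\kappa^s(Q_n;K_{1,r})=\left\lceil \frac n2\right\rceil .$$ -/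

import Mathlib

/-- The `n`-dimensional hypercube `Q_n`: the vertices are the binary strings of length `n`, two of
them being adjacent iff they differ in exactly one position. -/
def hypercube (n : ℕ) : SimpleGraph (Fin n → Bool) where
  Adj u v := hammingDist u v = 1
  symm := ⟨fun u v h => by rw [hammingDist_comm]; exact h⟩
  loopless := ⟨fun u h => by simp at h⟩

/-- The star `K_{1,r}` with `r` leaves. -/
def completeStar (r : ℕ) : SimpleGraph (Fin 1 ⊕ Fin r) :=
  completeBipartiteGraph (Fin 1) (Fin r)

/-- The graph `G - F`: all vertices of all members of `F` are deleted from `G`. -/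
def deleteFamily {V : Type*} (G : SimpleGraph V) (F : Set G.Subgraph) :
    SimpleGraph {v : V // v ∉ ⋃ H ∈ F, H.verts} :=
  G.comap Subtype.val

/-- A graph is disconnected if it has more than one component, i.e. two of its vertices are not
joined by a walk. The graph without vertices is not disconnected. -/
def IsDisconnected {V : Type*} (G : SimpleGraph V) : Prop :=
  ¬ G.Preconnected

/-- `F` is a `T`-structure-cut of `G`: every member of `F` is isomorphic to `T`, and `G - F` is
disconnected. -/
def IsStructureCut {V W : Type*} (G : SimpleGraph V) (T : SimpleGraph W)
    (F : Set G.Subgraph) : Prop :=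
  (∀ H ∈ F, Nonempty (H.coe ≃g T)) ∧ IsDisconnected (deleteFamily G F)

/-- `F` is a `T`-substructure-cut of `G`: every member of `F` is isomorphic to a connected
subgraph of `T`, and `G - F` is disconnected. -/
def IsSubstructureCut {V W : Type*} (G : SimpleGraph V) (T : SimpleGraph W)
    (F : Set G.Subgraph) : Prop :=
  (∀ H ∈ F, ∃ T' : T.Subgraph, T'.Connected ∧ Nonempty (H.coe ≃g T'.coe)) ∧
    IsDisconnected (deleteFamily G F)

/-- The `T`-structure connectivity `κ(G, T)`: the minimum cardinality of a `T`-structure-cut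
of `G` (`⊤` if there is no such cut). -/
noncomputable def structureConnectivity {V W : Type*} (G : SimpleGraph V) (T : SimpleGraph W) :
    ℕ∞ :=
  sInf {c | ∃ F : Set G.Subgraph, IsStructureCut G T F ∧ F.encard = c}

/-- The `T`-substructure connectivity `κˢ(G, T)`: the minimum cardinality of a
`T`-substructure-cut of `G` (`⊤` if there is no such cut). -/
noncomputable def substructureConnectivity {V W : Type*} (G : SimpleGraph V)
    (T : SimpleGraph W) : ℕ∞ :=
  sInf {c | ∃ F : Set G.Subgraph, IsSubstructureCut G T F ∧ F.encard = c}

/-- The threshold function `f(r)`, used for integers `r ≥ 2` only. -/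
def starThreshold (r : ℕ) : ℚ :=
  if Odd r then
    max (((r : ℚ) + 7) / 2) (((r : ℚ) ^ 2 + 4 * r + 3) / 8)
  else
    max (((r : ℚ) ^ 2 + 2 * r) / 8) (max (((r : ℚ) + 8) / 2) (((r : ℚ) ^ 2 + 6 * r + 12) / 12))

/-!
Lower bound: if stars with a set `A` of centres and a set `B` of single vertices are deleted from
`Q_n`, and `2|A| + |B| < n`, then the rest is connected. By induction on `n`, split the cube into
two faces along a coordinate in which two members of `A ∪ B` differ. In each face, a star centred
in the other face shrinks to a single vertex, so `2|A| + |B|` drops and the rest of each face is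
connected; a count of the deleted vertices leaves an edge that joins the two faces.

Upper bound: isolate a vertex `z` by stars centred at distance `2` from `z`, each of which contains
two neighbours of `z`. The deleted vertices at even distance from `z` are exactly the centres, so
any other vertex at distance `2` survives.
-/

open SimpleGraph

section StructureCut

variable {V W W' : Type*} {G : SimpleGraph V} {T : SimpleGraph W} {T' : SimpleGraph W'}
  {F : Set G.Subgraph}

theorem structureConnectivity_le_encard (hF : IsStructureCut G T F) :
    structureConnectivity G T ≤ F.encard :=
  sInf_le ⟨F, hF, rfl⟩

theorem IsStructureCut.isSubstructureCut (hF : IsStructureCut G T F) (hT : T.Connected)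
    (hTT' : T ⊑ T') : IsSubstructureCut G T' F := by
  obtain ⟨T₀, ⟨e₀⟩⟩ := hTT'.exists_iso_subgraph
  refine ⟨fun H hH => ?_, hF.2⟩
  obtain ⟨e⟩ := hF.1 H hH
  exact ⟨T₀, ⟨e₀.connected_iff.mp hT⟩, ⟨e₀.comp e⟩⟩

theorem substructureConnectivity_le_structureConnectivity (G : SimpleGraph V) (hT : T.Connected)
    (hTT' : T ⊑ T') : substructureConnectivity G T' ≤ structureConnectivity G T := by
  refine le_sInf ?_
  rintro _ ⟨F, hF, rfl⟩
  exact sInf_le ⟨F, hF.isSubstructureCut hT hTT', rfl⟩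

theorem isDisconnected_deleteFamily_of_isolated {z w : V} (hz : z ∉ ⋃ H ∈ F, H.verts)
    (hw : w ∉ ⋃ H ∈ F, H.verts) (hzw : z ≠ w) (hnbr : ∀ v, G.Adj z v → v ∈ ⋃ H ∈ F, H.verts) :
    IsDisconnected (deleteFamily G F) := by
  intro hconn
  have : Nontrivial {v // v ∉ ⋃ H ∈ F, H.verts} :=
    ⟨⟨z, hz⟩, ⟨w, hw⟩, fun h => hzw (congrArg Subtype.val h)⟩
  obtain ⟨v, hv⟩ := hconn.exists_adj_of_nontrivial ⟨z, hz⟩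
  exact v.2 (hnbr v hv)

end StructureCut

section Star

variable {V : Type*} {G : SimpleGraph V} {r s : ℕ}

theorem completeStar_connected (r : ℕ) : (completeStar r).Connected :=
  Connected.of_isUniversal (v := Sum.inl 0) fun w hw => by
    rcases w with k | k
    · exact absurd (congrArg Sum.inl (Subsingleton.elim 0 k)) hw
    · simp [completeStar]

/-- The copy of a star with centre `c` and leaves `leaf j`. -/
def starCopy {c : V} (leaf : Fin r ↪ V) (hleaf : ∀ j, G.Adj c (leaf j)) :
    Copy (completeStar r) G where
  toHom :=
    { toFun := Sum.elim (fun _ => c) leaf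
      map_rel' := by
        rintro (a | a) (b | b) h
        · simp [completeStar] at h
        · exact hleaf b
        · exact (hleaf a).symm
        · simp [completeStar] at h }
  injective' := by
    rintro (a | a) (b | b) h
    · exact congrArg Sum.inl (Subsingleton.elim a b)
    · exact absurd h (hleaf b).ne
    · exact absurd h (hleaf a).ne'
    · exact congrArg Sum.inr (leaf.injective h)

theorem verts_starCopy {c : V} (leaf : Fin r ↪ V) (hleaf : ∀ j, G.Adj c (leaf j)) :
    (starCopy leaf hleaf).toSubgraph.verts = insert c (Set.range leaf) := by
  ext v
  simp [starCopy, eq_comm]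

theorem completeStar_isContained_completeStar (hrs : r ≤ s) : completeStar r ⊑ completeStar s :=
  ⟨starCopy (c := Sum.inl 0) ((Fin.castLEEmb hrs).trans ⟨Sum.inr, Sum.inr_injective⟩)
    fun j => by simp [completeStar]⟩

theorem exists_subgraph_iso_completeStar {c : V} [Fintype (G.neighborSet c)] {L : Finset V}
    (hL : L ⊆ G.neighborFinset c) (hLr : L.card ≤ r) (hr : r ≤ G.degree c) :
    ∃ H : G.Subgraph, Nonempty (H.coe ≃g completeStar r) ∧ ↑L ⊆ H.verts ∧
      H.verts ⊆ insert c (G.neighborSet c) := by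
  obtain ⟨M, hLM, hM, rfl⟩ := Finset.exists_subsuperset_card_eq hL hLr hr
  let leaf : Fin M.card ↪ V := M.equivFin.symm.toEmbedding.trans (.subtype _)
  have hrange : Set.range leaf = M := by
    ext v
    constructor
    · rintro ⟨j, rfl⟩
      exact (M.equivFin.symm j).2
    · exact fun hv => ⟨M.equivFin ⟨v, hv⟩, by simp [leaf]⟩
  have hleaf (j) : G.Adj c (leaf j) :=
    (G.mem_neighborFinset c _).mp (hM (M.equivFin.symm j).2)
  refine ⟨(starCopy leaf hleaf).toSubgraph, ⟨(starCopy leaf hleaf).isoToSubgraph.symm⟩, ?_, ?_⟩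
  · rw [verts_starCopy, hrange]
    exact (Finset.coe_subset.mpr hLM).trans (Set.subset_insert _ _)
  · rw [verts_starCopy]
    exact Set.insert_subset_insert (Set.range_subset_iff.mpr hleaf)

theorem structureConnectivity_completeStar_le {ι : Type*} [G.LocallyFinite] (c : ι → V)
    (hdeg : ∀ k, r ≤ G.degree (c k)) (L : ι → Finset V)
    (hL : ∀ k, L k ⊆ G.neighborFinset (c k)) (hLr : ∀ k, (L k).card ≤ r) {z w : V} (hzw : z ≠ w)
    (hz : ∀ k, z ∉ insert (c k) (G.neighborSet (c k)))
    (hw : ∀ k, w ∉ insert (c k) (G.neighborSet (c k)))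
    (hcover : ∀ v, G.Adj z v → ∃ k, v ∈ L k) :
    structureConnectivity G (completeStar r) ≤ ENat.card ι := by
  choose H hiso hLH hH using fun k => exists_subgraph_iso_completeStar (hL k) (hLr k) (hdeg k)
  have hmem (v : V) : v ∈ ⋃ K ∈ Set.range H, K.verts ↔ ∃ k, v ∈ (H k).verts := by simp
  have hcut : IsStructureCut G (completeStar r) (Set.range H) := by
    refine ⟨Set.forall_mem_range.mpr hiso, isDisconnected_deleteFamily_of_isolated ?_ ?_ hzw ?_⟩
    · exact fun h => let ⟨k, hk⟩ := (hmem z).mp h; hz k (hH k hk)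
    · exact fun h => let ⟨k, hk⟩ := (hmem w).mp h; hw k (hH k hk)
    · exact fun v hv => let ⟨k, hk⟩ := hcover v hv; (hmem v).mpr ⟨k, hLH k hk⟩
  calc structureConnectivity G (completeStar r) ≤ (Set.range H).encard :=
        structureConnectivity_le_encard hcut
    _ ≤ ENat.card ι := by
      rw [← Set.image_univ, ← Set.encard_univ]
      exact Set.encard_image_le _ _

theorem exists_isUniversal_of_isVertexCover (hG : G.Connected) {C : Set V}
    (hC : G.IsVertexCover C) (hsub : C.Subsingleton) : ∃ c, G.IsUniversal c := by
  obtain ⟨c, hc⟩ : ∃ c, C ⊆ {c} := by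
    have := hG.nonempty
    rcases hsub.eq_empty_or_singleton with rfl | ⟨c, rfl⟩
    · exact ⟨Classical.arbitrary V, Set.empty_subset _⟩
    · exact ⟨c, subset_rfl⟩
  refine ⟨c, fun v hcv => ?_⟩
  have : Nontrivial V := ⟨c, v, hcv⟩
  obtain ⟨u, hvu⟩ := hG.preconnected.exists_adj_of_nontrivial v
  rcases hC hvu with hv | hu
  · exact absurd (hc hv).symm hcv
  · obtain rfl : u = c := hc hu
    exact hvu.symm

theorem exists_isUniversal_of_isContained_completeStar (hG : G.Connected)
    (hGr : G ⊑ completeStar r) : ∃ c, G.IsUniversal c := by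
  obtain ⟨f⟩ := hGr
  have hcover : (completeStar r).IsVertexCover {Sum.inl 0} := by
    rintro (a | a) (b | b) h
    all_goals simp [completeStar, Subsingleton.elim _ (0 : Fin 1)] at h ⊢
  exact exists_isUniversal_of_isVertexCover hG (hcover.preimage f.toHom)
    (Set.subsingleton_singleton.preimage f.injective)

end Star

theorem exists_forall_exists_apply_eq {ι : Type*} {s : Finset (ι → Bool)} (hs : s.Nontrivial) :
    ∃ i, ∀ b, ∃ v ∈ s, v i = b := by
  obtain ⟨u, hu, v, hv, huv⟩ := hs
  obtain ⟨i, hi⟩ := Function.ne_iff.mp huv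
  refine ⟨i, fun b => ?_⟩
  rcases Bool.eq_or_eq_not b (u i) with rfl | rfl
  · exact ⟨u, hu, rfl⟩
  · exact ⟨v, hv, Bool.eq_not.mpr hi.symm⟩

/-- The string obtained from `v` by switching its `i`-th entry: the neighbour of `v` in the
hypercube along the direction `i`. -/
def flipAt {ι : Type*} [DecidableEq ι] (v : ι → Bool) (i : ι) : ι → Bool :=
  Function.update v i (!v i)

section Flip

variable {ι : Type*} [DecidableEq ι]

@[simp]
theorem flipAt_same (v : ι → Bool) (i : ι) : flipAt v i i = !v i := by
  simp [flipAt]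

theorem flipAt_of_ne (v : ι → Bool) {i j : ι} (h : j ≠ i) : flipAt v i j = v j := by
  simp [flipAt, h]

theorem flipAt_apply_ne_iff (v : ι → Bool) {i j : ι} : flipAt v i j ≠ v j ↔ j = i := by
  by_cases h : j = i
  · simp [h]
  · simp [flipAt_of_ne v h, h]

@[simp]
theorem flipAt_flipAt (v : ι → Bool) (i : ι) : flipAt (flipAt v i) i = v := by
  simp [flipAt]

theorem flipAt_comm (v : ι → Bool) (i j : ι) :
    flipAt (flipAt v i) j = flipAt (flipAt v j) i := by
  rcases eq_or_ne i j with rfl | h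
  · rfl
  · simp only [flipAt, Function.update_of_ne h, Function.update_of_ne h.symm]
    exact Function.update_comm h _ _ _

theorem flipAt_injective (v : ι → Bool) : Function.Injective (flipAt v) := fun _ _ h =>
  (flipAt_apply_ne_iff v).mp (h ▸ (flipAt_apply_ne_iff v).mpr rfl)

theorem flipAt_flipAt_apply_ne_iff (v : ι → Bool) {a b i : ι} (hab : a ≠ b) :
    flipAt (flipAt v a) b i ≠ v i ↔ i = a ∨ i = b := by
  rcases eq_or_ne i b with rfl | hib
  · simp [flipAt_of_ne v hab.symm]
  · simp [flipAt_of_ne _ hib, flipAt_apply_ne_iff, hib]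

theorem hammingDist_flipAt_add_one [Fintype ι] {v w : ι → Bool} {i : ι} (h : v i ≠ w i) :
    hammingDist (flipAt v i) w + 1 = hammingDist v w := by
  have hfilter : ({j | flipAt v i j ≠ w j} : Finset ι) = ({j | v j ≠ w j} : Finset ι).erase i := by
    ext j
    rcases eq_or_ne j i with rfl | hj
    · simpa [Bool.eq_not] using h
    · simp [hj, flipAt_of_ne v hj]
  rw [hammingDist, hfilter, Finset.card_erase_add_one (by simpa using h), hammingDist]

theorem hammingDist_flipAt_of_eq [Fintype ι] {v w : ι → Bool} {i : ι} (h : v i = w i) :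
    hammingDist (flipAt v i) w = hammingDist v w + 1 := by
  simpa using (hammingDist_flipAt_add_one (v := flipAt v i) (w := w) (i := i) (by simp [h])).symm

end Flip

section Hypercube

variable {n : ℕ}

theorem hypercube_adj_iff_exists_flipAt {u v : Fin n → Bool} :
    (hypercube n).Adj u v ↔ ∃ i, v = flipAt u i := by
  change hammingDist u v = 1 ↔ _
  constructor
  · intro h
    obtain ⟨i, hi⟩ := Function.ne_iff.mp (hammingDist_pos.mp (h ▸ one_pos))
    have hdist : hammingDist (flipAt u i) v = 0 := by
      rw [← hammingDist_flipAt_add_one hi] at h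
      exact Nat.succ_injective h
    exact ⟨i, (eq_of_hammingDist_eq_zero hdist).symm⟩
  · rintro ⟨i, rfl⟩
    rw [hammingDist_comm, hammingDist_flipAt_of_eq rfl, hammingDist_self]

theorem hypercube_adj_flipAt (v : Fin n → Bool) (i : Fin n) :
    (hypercube n).Adj v (flipAt v i) :=
  hypercube_adj_iff_exists_flipAt.mpr ⟨i, rfl⟩

theorem even_hammingDist_iff_of_hypercube_adj {u v : Fin n → Bool} (h : (hypercube n).Adj u v)
    (w : Fin n → Bool) : Even (hammingDist v w) ↔ ¬Even (hammingDist u w) := by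
  obtain ⟨i, rfl⟩ := hypercube_adj_iff_exists_flipAt.mp h
  by_cases hi : u i = w i
  · rw [hammingDist_flipAt_of_eq hi, Nat.even_add_one]
  · rw [← hammingDist_flipAt_add_one hi, Nat.even_add_one, not_not]

theorem hypercube_degree (v : Fin n → Bool) [Fintype ((hypercube n).neighborSet v)] :
    (hypercube n).degree v = n := by
  have hnbr : (hypercube n).neighborFinset v = Finset.univ.image (flipAt v) := by
    ext w
    simp [hypercube_adj_iff_exists_flipAt, eq_comm]
  rw [← card_neighborFinset_eq_degree, hnbr,
    Finset.card_image_of_injective _ (flipAt_injective v), Finset.card_fin]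

theorem card_hammingDist_le_one (c : Fin n → Bool) :
    ({v | hammingDist v c ≤ 1} : Finset (Fin n → Bool)).card ≤ n + 1 := by
  have hsub : ({v | hammingDist v c ≤ 1} : Finset (Fin n → Bool)) ⊆
      insert c (Finset.univ.image (flipAt c)) := by
    intro v hv
    rw [Finset.mem_filter_univ, Nat.le_one_iff_eq_zero_or_eq_one, hammingDist_eq_zero] at hv
    rcases hv with rfl | hv
    · exact Finset.mem_insert_self _ _
    · obtain ⟨i, rfl⟩ := hypercube_adj_iff_exists_flipAt.mp ((hammingDist_comm c v).trans hv)
      simp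
  calc _ ≤ (insert c (Finset.univ.image (flipAt c))).card := Finset.card_le_card hsub
    _ ≤ (Finset.univ.image (flipAt c)).card + 1 := Finset.card_insert_le _ _
    _ ≤ n + 1 := by simpa using Finset.card_image_le (s := Finset.univ) (f := flipAt c)

theorem preconnected_induce_of_flipAt_mem {K : Set (Fin n → Bool)} (w : Fin n → Bool)
    (hK : ∀ v ∈ K, ∀ i, v i ≠ w i → flipAt v i ∈ K) :
    ((hypercube n).induce K).Preconnected := by
  have hreach (d : ℕ) (v : K) (hd : hammingDist v.1 w = d) :
      ∃ hw : w ∈ K, ((hypercube n).induce K).Reachable v ⟨w, hw⟩ := by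
    induction d generalizing v with
    | zero =>
      obtain rfl := eq_of_hammingDist_eq_zero hd
      exact ⟨v.2, .rfl⟩
    | succ d ih =>
      obtain ⟨i, hi⟩ := Function.ne_iff.mp (hammingDist_pos.mp (d.succ_pos.trans_eq hd.symm))
      rw [← hammingDist_flipAt_add_one hi] at hd
      obtain ⟨hw, hvw⟩ := ih ⟨flipAt v i, hK v v.2 i hi⟩ (Nat.succ_injective hd)
      have hstep : ((hypercube n).induce K).Adj v ⟨flipAt v i, hK v v.2 i hi⟩ :=
        hypercube_adj_flipAt v.1 i
      exact ⟨hw, hstep.reachable.trans hvw⟩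
  intro u v
  obtain ⟨hw, huw⟩ := hreach _ u rfl
  obtain ⟨_, hvw⟩ := hreach _ v rfl
  exact huw.trans hvw.symm

theorem preconnected_induce_compl_of_subset_ball {S : Set (Fin n → Bool)} (c : Fin n → Bool)
    (hS : ∀ v ∈ S, hammingDist v c ≤ 1) (hc : S.Nonempty → c ∈ S) :
    ((hypercube n).induce Sᶜ).Preconnected := by
  -- A step towards the antipode of `c` leads away from `c`, so it enters `S` only from `c`.
  refine preconnected_induce_of_flipAt_mem (fun j => !c j) fun v hv i hi hflip => hv ?_
  have hdist : hammingDist v c + 1 ≤ 1 := by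
    rw [← hammingDist_flipAt_of_eq (Bool.not_eq_not.mp hi)]
    exact hS _ hflip
  obtain rfl : v = c := eq_of_hammingDist_eq_zero (by omega)
  exact hc ⟨_, hflip⟩

theorem hammingDist_insertNth {α : Type*} [DecidableEq α] (i : Fin (n + 1)) (a b : α)
    (x y : Fin n → α) :
    hammingDist (Fin.insertNth (α := fun _ => α) i a x) (Fin.insertNth (α := fun _ => α) i b y) =
      (if a = b then 0 else 1) + hammingDist x y := by
  simp only [hammingDist, Finset.card_filter, Fin.sum_univ_succAbove _ i,
    Fin.insertNth_apply_same, Fin.insertNth_apply_succAbove, ne_eq, ite_not]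

/-- The embedding of `Q_n` into `Q_{n+1}` as the face on which the `i`-th entry is `b`. -/
def face (i : Fin (n + 1)) (b : Bool) : hypercube n ↪g hypercube (n + 1) where
  toFun := Fin.insertNth (α := fun _ => Bool) i b
  inj' := Fin.insertNth_right_injective (α := fun _ => Bool) b
  map_rel_iff' {x y} := by
    change hammingDist _ _ = 1 ↔ hammingDist x y = 1
    rw [Function.Embedding.coeFn_mk, hammingDist_insertNth, if_pos rfl, zero_add]

theorem hammingDist_face (i : Fin (n + 1)) (a b : Bool) (x y : Fin n → Bool) :
    hammingDist (face i a x) (face i b y) = (if a = b then 0 else 1) + hammingDist x y :=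
  hammingDist_insertNth i a b x y

@[simp]
theorem face_apply_same (i : Fin (n + 1)) (b : Bool) (x : Fin n → Bool) : face i b x i = b :=
  Fin.insertNth_apply_same (α := fun _ => Bool) i b x

theorem exists_face_eq (i : Fin (n + 1)) (v : Fin (n + 1) → Bool) : ∃ b x, face i b x = v :=
  ⟨v i, i.removeNth v, Fin.insertNth_self_removeNth i v⟩

theorem range_face (i : Fin (n + 1)) (b : Bool) : Set.range (face i b) = {v | v i = b} := by
  ext v
  obtain ⟨a, x, rfl⟩ := exists_face_eq i v
  constructor
  · rintro ⟨y, hy⟩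
    simp [← hy]
  · rintro h
    exact ⟨x, by rw [← face_apply_same i a x, show face i a x i = b from h]⟩

/-- The strings `x` with `face i b x ∈ A`. -/
noncomputable def faceSlice (i : Fin (n + 1)) (b : Bool) (A : Finset (Fin (n + 1) → Bool)) :
    Finset (Fin n → Bool) :=
  A.preimage (face i b) (face i b).injective.injOn

@[simp]
theorem mem_faceSlice {i : Fin (n + 1)} {b : Bool} {A : Finset (Fin (n + 1) → Bool)}
    {x : Fin n → Bool} : x ∈ faceSlice i b A ↔ face i b x ∈ A :=
  Finset.mem_preimage

theorem card_faceSlice (i : Fin (n + 1)) (b : Bool) (A : Finset (Fin (n + 1) → Bool)) :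
    (faceSlice i b A).card = (A.filter fun v => v i = b).card := by
  rw [faceSlice, Finset.card_preimage]
  simp only [range_face, Set.mem_ofPred_eq]

theorem card_faceSlice_add_card_faceSlice_not (i : Fin (n + 1)) (b : Bool)
    (A : Finset (Fin (n + 1) → Bool)) :
    (faceSlice i b A).card + (faceSlice i (!b) A).card = A.card := by
  simp only [card_faceSlice, Bool.eq_not]
  exact Finset.card_filter_add_card_filter_not _

theorem preconnected_induce_of_faces {K : Set (Fin (n + 1) → Bool)} (i : Fin (n + 1))
    (hface : ∀ b, ((hypercube n).induce (face i b ⁻¹' K)).Preconnected)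
    (hcross : ∃ x, ∀ b, face i b x ∈ K) : ((hypercube (n + 1)).induce K).Preconnected := by
  obtain ⟨x, hx⟩ := hcross
  have hwithin (b : Bool) (y : Fin n → Bool) (hy : face i b y ∈ K) :
      ((hypercube (n + 1)).induce K).Reachable ⟨face i b y, hy⟩ ⟨face i b x, hx b⟩ :=
    (hface b ⟨y, hy⟩ ⟨x, hx b⟩).map
      (induceHom (face i b).toHom (Set.mapsTo_preimage _ K))
  have hacross (a b : Bool) :
      ((hypercube (n + 1)).induce K).Reachable ⟨face i a x, hx a⟩ ⟨face i b x, hx b⟩ := by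
    rcases eq_or_ne a b with rfl | h
    · exact .rfl
    · exact Adj.reachable (show hammingDist _ _ = 1 by simp [hammingDist_face, h])
  rintro ⟨u, hu⟩ ⟨v, hv⟩
  obtain ⟨a, y, rfl⟩ := exists_face_eq i u
  obtain ⟨b, z, rfl⟩ := exists_face_eq i v
  exact ((hwithin a y hu).trans (hacross a b)).trans (hwithin b z hv).symm

end Hypercube

section StarCover

variable {n : ℕ} {S : Set (Fin n → Bool)} {A B : Finset (Fin n → Bool)}

/-- `S` is made up of subsets of the closed neighbourhoods of the centres in `A`, which belong to
`S` themselves, and of single vertices from `B`. -/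
structure IsStarCover (S : Set (Fin n → Bool)) (A B : Finset (Fin n → Bool)) : Prop where
  center_mem : ∀ c ∈ A, c ∈ S
  mem_or_near : ∀ v ∈ S, v ∈ B ∨ ∃ c ∈ A, hammingDist v c ≤ 1

theorem IsStarCover.preimage_face {S : Set (Fin (n + 1) → Bool)}
    {A B : Finset (Fin (n + 1) → Bool)} (h : IsStarCover S A B) (i : Fin (n + 1)) (b : Bool) :
    IsStarCover (face i b ⁻¹' S) (faceSlice i b A) (faceSlice i b B ∪ faceSlice i (!b) A) where
  center_mem c hc := h.center_mem _ (mem_faceSlice.mp hc)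
  mem_or_near x hx := by
    simp only [Finset.mem_union, mem_faceSlice]
    rcases h.mem_or_near _ hx with hxB | ⟨c, hc, hxc⟩
    · exact Or.inl (Or.inl hxB)
    obtain ⟨a, y, rfl⟩ := exists_face_eq i c
    rw [hammingDist_face] at hxc
    rcases Bool.eq_or_eq_not a b with rfl | rfl
    · exact Or.inr ⟨y, hc, by simpa using hxc⟩
    · obtain rfl : x = y := eq_of_hammingDist_eq_zero (by simpa using hxc)
      exact Or.inl (Or.inr hc)

theorem mul_succ_lt_two_pow_succ (n : ℕ) : n * (n + 1) < 2 ^ (n + 1) := by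
  induction n with
  | zero => simp
  | succ n ih =>
    have hpow : n + 1 ≤ 2 ^ n := Nat.lt_two_pow_self
    calc (n + 1) * (n + 1 + 1) = n * (n + 1) + 2 * (n + 1) := by ring
      _ < 2 ^ (n + 1) + 2 * 2 ^ n := by omega
      _ = 2 ^ (n + 1 + 1) := by ring

theorem mul_succ_add_lt_two_pow {a b n : ℕ} (h : 2 * a + b ≤ n) : a * (n + 1) + b < 2 ^ n := by
  have hb : 2 * b ≤ b * (n + 1) := by
    rcases b.eq_zero_or_pos with rfl | hb
    · simp
    · nlinarith
  have hdouble : 2 * (a * (n + 1) + b) < 2 * 2 ^ n :=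
    calc 2 * (a * (n + 1) + b) ≤ (2 * a + b) * (n + 1) := by linarith
      _ ≤ n * (n + 1) := Nat.mul_le_mul_right _ h
      _ < 2 * 2 ^ n := by rw [← pow_succ']; exact mul_succ_lt_two_pow_succ n
  omega

theorem IsStarCover.exists_forall_face_notMem {S : Set (Fin (n + 1) → Bool)}
    {A B : Finset (Fin (n + 1) → Bool)} (h : IsStarCover S A B) (hcard : 2 * A.card + B.card ≤ n)
    (i : Fin (n + 1)) : ∃ x, ∀ b, face i b x ∉ S := by
  by_contra! hmeet
  -- The projections of the stars and single vertices are too small to fill `Q_n`.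
  have hcover : Finset.univ ⊆ (A.biUnion fun c => {x | hammingDist x (i.removeNth c) ≤ 1}) ∪
      B.image i.removeNth := by
    intro x _
    obtain ⟨b, hb⟩ := hmeet x
    simp only [Finset.mem_union, Finset.mem_biUnion, Finset.mem_filter_univ, Finset.mem_image]
    rcases h.mem_or_near _ hb with hxB | ⟨c, hc, hxc⟩
    · exact Or.inr ⟨_, hxB, Fin.removeNth_insertNth (α := fun _ => Bool) i b x⟩
    · refine Or.inl ⟨c, hc, ?_⟩
      rw [← Fin.insertNth_self_removeNth i c] at hxc
      exact (Nat.le_add_left _ _).trans ((hammingDist_insertNth i b _ x _).symm.le.trans hxc)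
  have hle : 2 ^ n ≤ A.card * (n + 1) + B.card :=
    calc 2 ^ n = (Finset.univ : Finset (Fin n → Bool)).card := by simp
      _ ≤ _ := Finset.card_le_card hcover
      _ ≤ _ := Finset.card_union_le _ _
      _ ≤ _ := Nat.add_le_add
        (Finset.card_biUnion_le_card_mul A _ (n + 1) fun _ _ => card_hammingDist_le_one _)
        Finset.card_image_le
  exact (mul_succ_add_lt_two_pow hcard).not_ge hle

theorem IsStarCover.preconnected_of_subset_singleton
    (h : IsStarCover S A B) {c : Fin n → Bool} (hAB : A ∪ B ⊆ {c}) :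
    ((hypercube n).induce Sᶜ).Preconnected := by
  have hA : ∀ v ∈ A, v = c := fun v hv => Finset.mem_singleton.mp (hAB (Finset.mem_union_left _ hv))
  have hB : ∀ v ∈ B, v = c := fun v hv =>
    Finset.mem_singleton.mp (hAB (Finset.mem_union_right _ hv))
  refine preconnected_induce_compl_of_subset_ball c (fun v hv => ?_) fun ⟨v, hv⟩ => ?_
  · rcases h.mem_or_near v hv with hvB | ⟨a, ha, hva⟩
    · simp [hB v hvB]
    · exact hA a ha ▸ hva
  · rcases h.mem_or_near v hv with hvB | ⟨a, ha, -⟩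
    · exact hB v hvB ▸ hv
    · exact hA a ha ▸ h.center_mem a ha

theorem IsStarCover.preconnected_induce_compl (h : IsStarCover S A B)
    (hcard : 2 * A.card + B.card < n) : ((hypercube n).induce Sᶜ).Preconnected := by
  induction n with
  | zero => omega
  | succ n ih =>
    rcases (A ∪ B).eq_empty_or_nonempty with hempty | hne
    · exact h.preconnected_of_subset_singleton (c := fun _ => false) (by simp [hempty])
    rcases hne.exists_eq_singleton_or_nontrivial with ⟨c, hc⟩ | hAB
    · exact h.preconnected_of_subset_singleton hc.subset
    obtain ⟨i, hi⟩ := exists_forall_exists_apply_eq hAB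
    refine preconnected_induce_of_faces i (fun b => ih (h.preimage_face i b) ?_)
      (h.exists_forall_face_notMem (by omega) i)
    have hopposite : 0 < (faceSlice i (!b) A).card + (faceSlice i (!b) B).card := by
      obtain ⟨v, hv, hvb⟩ := hi (!b)
      rw [card_faceSlice, card_faceSlice]
      rcases Finset.mem_union.mp hv with hv | hv
      · exact Nat.add_pos_left (Finset.card_pos.mpr ⟨v, Finset.mem_filter.mpr ⟨hv, hvb⟩⟩) _
      · exact Nat.add_pos_right _ (Finset.card_pos.mpr ⟨v, Finset.mem_filter.mpr ⟨hv, hvb⟩⟩)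
    have hA := card_faceSlice_add_card_faceSlice_not i b A
    have hB := card_faceSlice_add_card_faceSlice_not i b B
    have hunion := Finset.card_union_le (faceSlice i b B) (faceSlice i (!b) A)
    omega

end StarCover

section Hypercube

variable {n r : ℕ}

theorem exists_mem_verts_forall_hammingDist_le_one {H : (hypercube n).Subgraph}
    (hH : H.coe.Connected) (hHr : H.coe ⊑ completeStar r) :
    ∃ c ∈ H.verts, ∀ v ∈ H.verts, hammingDist v c ≤ 1 := by
  obtain ⟨c, hc⟩ := exists_isUniversal_of_isContained_completeStar hH hHr
  refine ⟨c, c.2, fun v hv => ?_⟩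
  rcases eq_or_ne c ⟨v, hv⟩ with rfl | hcv
  · simp
  · exact (H.adj_sub (hc hcv).symm).le

theorem exists_isStarCover_biUnion_verts
    (F : Finset (hypercube n).Subgraph)
    (hF : ∀ H ∈ F, ∃ c ∈ H.verts, ∀ v ∈ H.verts, hammingDist v c ≤ 1) :
    ∃ A : Finset (Fin n → Bool), A.card ≤ F.card ∧ IsStarCover (⋃ H ∈ F, H.verts) A ∅ := by
  choose! c hcH hball using hF
  refine ⟨F.image c, Finset.card_image_le, fun v hv => ?_, fun v hv => ?_⟩
  · obtain ⟨H, hH, rfl⟩ := Finset.mem_image.mp hv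
    exact Set.mem_biUnion hH (hcH H hH)
  · obtain ⟨H, hH, hv⟩ := Set.mem_iUnion₂.mp hv
    exact Or.inr ⟨c H, Finset.mem_image_of_mem c hH, hball H hH v hv⟩

theorem ceil_half_le_substructureConnectivity (r n : ℕ) :
    ((⌈(n : ℚ) / 2⌉₊ : ℕ) : ℕ∞) ≤
      substructureConnectivity (hypercube n) (completeStar r) := by
  refine le_sInf ?_
  rintro _ ⟨F, ⟨hstar, hdis⟩, rfl⟩
  by_contra! hlt
  obtain ⟨F, rfl⟩ := (Set.finite_of_encard_le_coe hlt.le).exists_finset_coe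
  have hcard : 2 * F.card < n := by
    rw [Set.encard_coe_eq_coe_finsetCard, Nat.cast_lt, Nat.lt_ceil, lt_div_iff₀ two_pos] at hlt
    rw [mul_comm]
    exact_mod_cast hlt
  obtain ⟨A, hA, hcover⟩ := exists_isStarCover_biUnion_verts F fun H hH => by
    obtain ⟨T, hT, ⟨e⟩⟩ := hstar H hH
    exact exists_mem_verts_forall_hammingDist_le_one (e.connected_iff.mpr hT.coe)
      (T.coe_isContained.trans' ⟨e.toCopy⟩)
  exact hdis (hcover.preconnected_induce_compl (by rw [Finset.card_empty]; omega))

theorem notMem_insert_neighborSet_of_even {z u c : Fin n → Bool} (hu : Even (hammingDist u z))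
    (hc : Even (hammingDist c z)) (huc : u ≠ c) :
    u ∉ insert c ((hypercube n).neighborSet c) := by
  rintro (rfl | hadj)
  · exact huc rfl
  · exact (even_hammingDist_iff_of_hypercube_adj hadj z).mp hu hc

/-- Each pair `p k ≠ q k` gives the star centred at `flipAt (flipAt z (p k)) (q k)`, which deletes
the neighbours of `z` in the directions `p k` and `q k`. -/
theorem structureConnectivity_hypercube_completeStar_le_card {ι : Type*} (hr : 2 ≤ r)
    (hrn : r ≤ n) {p q : ι → Fin n} (hpq : ∀ k, p k ≠ q k) (hcover : ∀ i, ∃ k, i = p k ∨ i = q k)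
    {a b : Fin n} (hab : a ≠ b) (hne : ∀ k, s(p k, q k) ≠ s(a, b)) :
    structureConnectivity (hypercube n) (completeStar r) ≤ ENat.card ι := by
  classical
  let z : Fin n → Bool := fun _ => false
  let corner (i j : Fin n) : Fin n → Bool := flipAt (flipAt z i) j
  have hadj (i j) : (hypercube n).Adj (corner i j) (flipAt z i) :=
    (hypercube_adj_flipAt _ j).symm
  have hdist {i j} (hij : i ≠ j) : hammingDist (corner i j) z = 2 := by
    rw [hammingDist_flipAt_of_eq (flipAt_of_ne z hij.symm), hammingDist_flipAt_of_eq rfl,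
      hammingDist_self]
  have heven {i j} (hij : i ≠ j) : Even (hammingDist (corner i j) z) := by
    rw [hdist hij]
    exact even_two
  have hcorner_ne {i j} (hij : i ≠ j) : z ≠ corner i j := by
    rw [ne_comm, ← hammingDist_pos, hdist hij]
    exact two_pos
  refine structureConnectivity_completeStar_le (c := fun k => corner (p k) (q k))
    (fun k => by rwa [hypercube_degree]) (L := fun k => {flipAt z (p k), flipAt z (q k)})
    (fun k => ?_) (fun k => Finset.card_le_two.trans hr) (hcorner_ne hab)
    (fun k => notMem_insert_neighborSet_of_even (by simp) (heven (hpq k)) (hcorner_ne (hpq k)))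
    (fun k => notMem_insert_neighborSet_of_even (heven hab) (heven (hpq k)) fun h => hne k ?_)
    fun v hv => ?_
  · have hq : (hypercube n).Adj (corner (p k) (q k)) (flipAt z (q k)) := by
      simpa only [corner, flipAt_comm z (p k)] using hadj (q k) (p k)
    simp [Finset.insert_subset_iff, hadj, hq]
  · ext i
    rw [Sym2.mem_iff, Sym2.mem_iff, ← flipAt_flipAt_apply_ne_iff z (hpq k),
      ← flipAt_flipAt_apply_ne_iff z hab]
    change corner (p k) (q k) i ≠ z i ↔ corner a b i ≠ z i
    rw [h]
  · obtain ⟨i, rfl⟩ := hypercube_adj_iff_exists_flipAt.mp hv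
    obtain ⟨k, rfl | rfl⟩ := hcover i <;> exact ⟨k, by simp⟩

theorem exists_pairs_cover (hn : 3 ≤ n) :
    ∃ p q : Fin ((n + 1) / 2) → Fin n, (∀ k, p k ≠ q k) ∧ (∀ i, ∃ k, i = p k ∨ i = q k) ∧
      ∃ a b, a ≠ b ∧ ∀ k, s(p k, q k) ≠ s(a, b) := by
  -- The pairs are `{0, 1}, {2, 3}, …`, closed by `{n - 1, 0}` if `n` is odd; they omit `{1, 2}`.
  let q (k : Fin ((n + 1) / 2)) : Fin n :=
    if h : 2 * k.1 + 1 < n then ⟨2 * k + 1, h⟩ else ⟨0, by omega⟩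
  have hq (k) : (q k).1 = if 2 * k.1 + 1 < n then 2 * k.1 + 1 else 0 := apply_dite Fin.val _ _ _
  refine ⟨fun k => ⟨2 * k, by omega⟩, q, fun k => ?_, fun i => ⟨⟨i / 2, by omega⟩, ?_⟩,
    ⟨1, by omega⟩, ⟨2, by omega⟩, by simp, fun k => ?_⟩
  all_goals simp only [ne_eq, Sym2.eq_iff, Fin.ext_iff, hq]
  · have := k.isLt
    split_ifs <;> omega
  · have := i.isLt
    split_ifs <;> omega
  · rintro (⟨hp, -⟩ | ⟨hp, hqk⟩)
    · omega
    · split_ifs at hqk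
      omega

theorem ceil_half_eq (n : ℕ) : ⌈(n : ℚ) / 2⌉₊ = (n + 1) / 2 := by
  refine eq_of_forall_ge_iff fun m => ?_
  rw [Nat.ceil_le, div_le_iff₀ two_pos, show (n : ℚ) ≤ m * 2 ↔ n ≤ m * 2 by norm_cast]
  omega

theorem structureConnectivity_le_ceil_half (hr : 2 ≤ r) (hrn : r ≤ n) (hn : 3 ≤ n) :
    structureConnectivity (hypercube n) (completeStar r) ≤ ((⌈(n : ℚ) / 2⌉₊ : ℕ) : ℕ∞) := by
  obtain ⟨p, q, hpq, hcover, a, b, hab, hne⟩ := exists_pairs_cover hn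
  simpa [ceil_half_eq] using
    structureConnectivity_hypercube_completeStar_le_card hr hrn hpq hcover hab hne

end Hypercube

theorem le_and_three_le_of_starThreshold_lt {r n : ℕ} (hn : starThreshold r < (n : ℚ)) :
    r ≤ n ∧ 3 ≤ n := by
  unfold starThreshold at hn
  have hbounds : (r : ℚ) + 7 < 2 * n ∧ (r : ℚ) ^ 2 + 2 * r < 8 * n := by
    split_ifs at hn <;> simp only [max_lt_iff] at hn <;> constructor <;> linarith
  obtain ⟨hlinear, hquadratic⟩ := hbounds
  have hlinear : r + 7 < 2 * n := by exact_mod_cast hlinear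
  have hquadratic : r ^ 2 + 2 * r < 8 * n := by exact_mod_cast hquadratic
  refine ⟨?_, by omega⟩
  by_contra! hlt
  nlinarith

/-- For `r > n` the cube contains no star with `r` leaves, so the structure connectivity is `⊤`. -/
theorem theorem3p13_general {r n : ℕ} (hr : 2 ≤ r) (hn : 3 ≤ n) :
    (r ≤ n → structureConnectivity (hypercube n) (completeStar r) = (⌈(n : ℚ) / 2⌉₊ : ℕ)) ∧
      substructureConnectivity (hypercube n) (completeStar r) = (⌈(n : ℚ) / 2⌉₊ : ℕ) := by
  have hlower := ceil_half_le_substructureConnectivity r n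
  refine ⟨fun hrn => le_antisymm (structureConnectivity_le_ceil_half hr hrn hn) ?_,
    le_antisymm ?_ hlower⟩
  · exact hlower.trans (substructureConnectivity_le_structureConnectivity _
      (completeStar_connected r) .rfl)
  · exact (substructureConnectivity_le_structureConnectivity _ (completeStar_connected 2)
      (completeStar_isContained_completeStar hr)).trans
      (structureConnectivity_le_ceil_half le_rfl (by omega) hn)

theorem theorem3p13 (r n : ℕ) (hr : 2 ≤ r) (hn : starThreshold r < (n : ℚ)) :
    structureConnectivity (hypercube n) (completeStar r) = ((⌈(n : ℚ) / 2⌉₊ : ℕ) : ℕ∞) ∧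
      substructureConnectivity (hypercube n) (completeStar r) = ((⌈(n : ℚ) / 2⌉₊ : ℕ) : ℕ∞) := by
  obtain ⟨hrn, hn3⟩ := le_and_three_le_of_starThreshold_lt hn
  exact (theorem3p13_general hr hn3).imp_left fun h => h hrn
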